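/- **Setting.** Let $\mathbf{A}$ be an additive category. Its Freyd category $\mathcal{A}(\mathbf{A})$ has as objects the morphisms $(a \xleftarrow{\rho_a} r_a)$ of $\mathbf{A}$; a morphism $(a \xleftarrow{\rho_a} r_a) \to (b \xleftarrow{\rho_b} r_b)$ is represented by a morphism $\alpha : a \to b$ for which there is $\omega : r_a \to r_b$ with $\alpha\circ\rho_a = \rho_b\circ\omega$, and $\alpha, \alpha'$ represent the same morphism iff $\alpha - \alpha'$ factors through $\rho_b$. An object $a$ of $\mathbf{A}$ is regarded as the object $(a \leftarrow 0)$ of $\mathcal{A}(\mathbf{A})$. Let $T : \mathbf{A}\times\mathbf{A} \to \mathcal{A}(\mathbf{A})$ be a functor that is additive in each variable, and let $-\otimes- : \mathcal{A}(\mathbf{A})\times\mathcal{A}(\mathbf{A}) \to \mathcal{A}(\mathbf{A})$ be its extension $$(a \xleftarrow{\rho_a} r_a)\otimes(b \xleftarrow{\rho_b} r_b) := \operatorname{coker}\Big(T(r_a,b)\oplus T(a,r_b) \xrightarrow{(T(\rho_a,\mathrm{id}),\,T(\mathrm{id},\rho_b))} T(a,b)\Big),$$ with the induced action on morphisms. A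 weak kernel of $\alpha: a\to b$ is a morphism $\iota : k \to a$ with $\alpha\circ\iota = 0$ through which every $\tau : t\to a$ with $\alpha\circ\tau=0$ factors, not necessarily uniquely. If $f : X \to Y$ is a morphism of $\mathcal{A}(\mathbf{A})$ and $(-\otimes X)\dashv \widehat{\mathrm{Hom}}(X,-)$, $(-\otimes Y)\dashv \widehat{\mathrm{Hom}}(Y,-)$ are given adjunctions, the induced map $\widehat{\mathrm{Hom}}(f,-) : \widehat{\mathrm{Hom}}(Y,-)\to\widehat{\mathrm{Hom}}(X,-)$ is the natural transformation that corresponds, under the adjunctions, to precomposition with $W\otimes f$ as a map $\mathrm{Hom}(W\otimes Y,Z)\to\mathrm{Hom}(W\otimes X,Z)$. **Theorem.** Suppose that $\mathbf{A}$ has weak kernels. Let $A = (a \xleftarrow{\rho_a} r_a)$ be an object of $\mathcal{A}(\mathbf{A})$, and suppose that right adjoints $(-\otimes a)\dashv\widehat{\mathrm{Hom}}(a,-)$ and $(-\otimes r_a)\dashv\widehat{\mathrm{Hom}}(r_a,-)$ of these endofunctors of $\mathcal{A}(\mathbf{A})$ are given. Then $(-\otimes A)$ has a right adjoint $\widehat{\mathrm{Hom}}(A,-)$,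 and it can be chosen as the kernel of $\widehat{\mathrm{Hom}}(\rho_a,-) : \widehat{\mathrm{Hom}}(a,-)\to\widehat{\mathrm{Hom}}(r_a,-)$: for every object $Z$ of $\mathcal{A}(\mathbf{A})$, the map $\widehat{\mathrm{Hom}}(A,Z)\to\widehat{\mathrm{Hom}}(a,Z)$ induced by the canonical morphism $a \to A$ is a kernel of $\widehat{\mathrm{Hom}}(\rho_a,Z)$. -/

import Mathlib

open CategoryTheory CategoryTheory.Limits CategoryTheory.Preadditive

universe v v₁ v₂ v₃ u u₁ u₂ u₃

/-! The Freyd category of an additive category `C` is Mathlib's `RightFreyd C`: its objects are the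
arrows `ρ : r ⟶ a` of `C` (with `left = r` and `right = a`), its morphisms are the pairs `(α, ω)` with
`ρ ≫ α = ω ≫ ρ'`, where `(α₁, ω₁)` and `(α₂, ω₂)` are identified when `α₁ - α₂` factors through `ρ'`.
Mathlib's `RightFreyd.functor C : C ⥤ RightFreyd C` is the embedding `a ↦ (a ⟵ 0)`. -/

namespace FreydTensor

noncomputable section

section Biproducts

variable {C : Type u} [Category.{v} C] [Preadditive C] [HasBinaryBiproducts C]

/-- The biproduct of `(a ⟵ r)` and `(a' ⟵ r')` is `(a ⊞ a' ⟵ r ⊞ r')`. -/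
instance hasBinaryBiproducts_rightFreyd : HasBinaryBiproducts (RightFreyd C) where
  has_binary_biproduct X Y := by
    let w : Arrow C := Arrow.mk (biprod.map X.as.hom Y.as.hom)
    let p₁ : w ⟶ X.as := Arrow.homMk biprod.fst biprod.fst (by simp [w])
    let p₂ : w ⟶ Y.as := Arrow.homMk biprod.snd biprod.snd (by simp [w])
    let i₁ : X.as ⟶ w := Arrow.homMk biprod.inl biprod.inl (by simp [w])
    let i₂ : Y.as ⟶ w := Arrow.homMk biprod.inr biprod.inr (by simp [w])
    have h₁ : i₁ ≫ p₁ = 𝟙 _ := by ext <;> simp [i₁, p₁, w]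
    have h₂ : i₁ ≫ p₂ = 0 := by ext <;> simp [i₁, p₂, w]
    have h₃ : i₂ ≫ p₁ = 0 := by ext <;> simp [i₂, p₁, w]
    have h₄ : i₂ ≫ p₂ = 𝟙 _ := by ext <;> simp [i₂, p₂, w]
    have h₅ : p₁ ≫ i₁ + p₂ ≫ i₂ = 𝟙 w := by
      ext
      · exact biprod.total (X := X.as.left) (Y := Y.as.left)
      · exact biprod.total (X := X.as.right) (Y := Y.as.right)
    let Q := RightFreyd.quotient C
    let b : BinaryBicone (Q.obj X.as) (Q.obj Y.as) :=
      { pt := Q.obj w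
        fst := Q.map p₁
        snd := Q.map p₂
        inl := Q.map i₁
        inr := Q.map i₂
        inl_fst := by rw [← Q.map_comp, h₁, Q.map_id]
        inl_snd := by rw [← Q.map_comp, h₂, Q.map_zero]
        inr_fst := by rw [← Q.map_comp, h₃, Q.map_zero]
        inr_snd := by rw [← Q.map_comp, h₄, Q.map_id] }
    exact hasBinaryBiproduct_of_total (X := Q.obj X.as) (Y := Q.obj Y.as) b (by
      change Q.map p₁ ≫ Q.map i₁ + Q.map p₂ ≫ Q.map i₂ = 𝟙 _
      rw [← Q.map_comp, ← Q.map_comp, ← Q.map_add, h₅, Q.map_id])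

end Biproducts

section Extension

variable {C : Type u₁} [Category.{v₁} C] {D : Type u₂} [Category.{v₂} D]
  {B : Type u₃} [Category.{v₃} B] [Preadditive B] [HasBinaryBiproducts B] [HasCokernels B]
  (F : C ⥤ D ⥤ B)

/-- The morphism `F(r, b) ⊞ F(a, s) ⟶ F(a, b)` attached to `u = (a ⟵ r)` and `w = (b ⟵ s)`. -/
def relMap (u : Arrow C) (w : Arrow D) :
    (F.obj u.left).obj w.right ⊞ (F.obj u.right).obj w.left ⟶ (F.obj u.right).obj w.right :=
  biprod.desc ((F.map u.hom).app w.right) ((F.obj u.right).map w.hom)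

/-- The value of the extension at the pair `u`, `w`. -/
abbrev extObj (u : Arrow C) (w : Arrow D) : B := cokernel (relMap F u w)

/-- The projection `F(a, b) ⟶ F̂(u, w)`. -/
def extπ (u : Arrow C) (w : Arrow D) : (F.obj u.right).obj w.right ⟶ extObj F u w :=
  cokernel.π (relMap F u w)

instance extπ_epi (u : Arrow C) (w : Arrow D) : Epi (extπ F u w) :=
  inferInstanceAs (Epi (cokernel.π (relMap F u w)))

theorem left_extπ (u : Arrow C) (w : Arrow D) :
    (F.map u.hom).app w.right ≫ extπ F u w = 0 := by
  have h : (F.map u.hom).app w.right = biprod.inl ≫ relMap F u w := by simp [relMap]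
  rw [h, Category.assoc, extπ, cokernel.condition, Limits.comp_zero]

theorem right_extπ (u : Arrow C) (w : Arrow D) :
    (F.obj u.right).map w.hom ≫ extπ F u w = 0 := by
  have h : (F.obj u.right).map w.hom = biprod.inr ≫ relMap F u w := by simp [relMap]
  rw [h, Category.assoc, extπ, cokernel.condition, Limits.comp_zero]

/-- The value of the extension at the pair of morphisms `f = (α, ω)`, `g = (β, τ)`: the map that
`F(α, β)` induces on the cokernels. -/
def extMap {u u' : Arrow C} {w w' : Arrow D} (f : u ⟶ u') (g : w ⟶ w') :
    extObj F u w ⟶ extObj F u' w' :=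
  cokernel.map (relMap F u w) (relMap F u' w')
    (biprod.map ((F.map f.left).app w.right ≫ (F.obj u'.left).map g.right)
      ((F.map f.right).app w.left ≫ (F.obj u'.right).map g.left))
    ((F.map f.right).app w.right ≫ (F.obj u'.right).map g.right)
    (by
      apply biprod.hom_ext'
      · have h := congrArg (fun t => (F.map t).app w.right) f.w
        simp only [Functor.map_comp, NatTrans.comp_app] at h
        simp only [relMap, biprod.inl_desc_assoc, biprod.inl_map_assoc, biprod.inl_desc,
          Category.assoc, NatTrans.naturality]
        erw [← reassoc_of% h]
      · have h := congrArg (fun t => (F.obj u'.right).map t) g.w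
        simp only [Functor.map_comp] at h
        simp only [relMap, biprod.inr_desc_assoc, biprod.inr_map_assoc, biprod.inr_desc,
          Category.assoc, NatTrans.naturality_assoc]
        erw [h])

theorem extπ_extMap {u u' : Arrow C} {w w' : Arrow D} (f : u ⟶ u') (g : w ⟶ w') :
    extπ F u w ≫ extMap F f g =
      (F.map f.right).app w.right ≫ (F.obj u'.right).map g.right ≫ extπ F u' w' := by
  rw [extπ, extMap, cokernel.π_desc, Category.assoc]
  rfl

theorem extMap_id (u : Arrow C) (w : Arrow D) : extMap F (𝟙 u) (𝟙 w) = 𝟙 _ := by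
  rw [← cancel_epi (extπ F u w), extπ_extMap]
  simp

theorem extMap_comp {u u' u'' : Arrow C} {w w' w'' : Arrow D} (f : u ⟶ u') (f' : u' ⟶ u'')
    (g : w ⟶ w') (g' : w' ⟶ w'') :
    extMap F (f ≫ f') (g ≫ g') = extMap F f g ≫ extMap F f' g' := by
  rw [← cancel_epi (extπ F u w), extπ_extMap, ← Category.assoc (extπ F u w), extπ_extMap,
    Category.assoc, Category.assoc, extπ_extMap]
  simp

variable [Preadditive C] [Preadditive D]

theorem extMap_congr [∀ d, (F.flip.obj d).Additive] [∀ c, (F.obj c).Additive]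
    {u u' : Arrow C} {w w' : Arrow D} {f f' : u ⟶ u'} {g g' : w ⟶ w'}
    (hf : Arrow.rightHomotopic C f f') (hg : Arrow.rightHomotopic D g g') :
    extMap F f g = extMap F f' g' := by
  obtain ⟨l, hl⟩ := hf
  obtain ⟨m, hm⟩ := hg
  have e₁ : extMap F f g = extMap F f' g := by
    rw [← cancel_epi (extπ F u w), extπ_extMap, extπ_extMap, ← sub_eq_zero, ← sub_comp]
    have h : (F.map f.right).app w.right - (F.map f'.right).app w.right =
        (F.map l).app w.right ≫ (F.map u'.hom).app w.right := by
      have := (F.flip.obj w.right).map_sub (f := f.right) (g := f'.right)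
      rw [hl, Functor.map_comp] at this
      exact this.symm
    rw [h, Category.assoc, ← NatTrans.naturality_assoc, left_extπ]
    simp
  have e₂ : extMap F f' g = extMap F f' g' := by
    rw [← cancel_epi (extπ F u w), extπ_extMap, extπ_extMap, ← sub_eq_zero, ← comp_sub,
      ← sub_comp, ← Functor.map_sub, hm, Functor.map_comp, Category.assoc, right_extπ]
    simp
  rw [e₁, e₂]

variable [∀ d, (F.flip.obj d).Additive] [∀ c, (F.obj c).Additive]

/-- The extension `F̂ : 𝒜(C) × 𝒜(D) ⟶ B` (in curried form) of a bilinear functor `F : C × D ⟶ B` to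
Freyd categories:
`F̂(a ⟵ r, b ⟵ s) = coker (F(r, b) ⊞ F(a, s) ⟶ F(a, b))`. -/
def extension : RightFreyd C ⥤ RightFreyd D ⥤ B :=
  CategoryTheory.Quotient.lift (Arrow.rightHomotopic C)
    { obj := fun u => CategoryTheory.Quotient.lift (Arrow.rightHomotopic D)
        { obj := fun w => extObj F u w
          map := fun g => extMap F (𝟙 u) g
          map_id := fun w => extMap_id F u w
          map_comp := fun g g' => by rw [← extMap_comp, Category.comp_id] }
        (fun _ _ _ _ h => extMap_congr F ⟨Arrow.RightHomotopy.refl _⟩ h)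
      map := fun f => CategoryTheory.Quotient.natTransLift (Arrow.rightHomotopic D)
        { app := fun w => extMap F f (𝟙 w)
          naturality := fun w w' g => by
            change extMap F (𝟙 _) g ≫ extMap F f (𝟙 _) = extMap F f (𝟙 _) ≫ extMap F (𝟙 _) g
            simp only [← extMap_comp, Category.comp_id, Category.id_comp] }
      map_id := fun u => by
        ext ⟨w⟩
        exact extMap_id F u w
      map_comp := fun f f' => by
        ext ⟨w⟩
        change extMap F (f ≫ f') (𝟙 w) = extMap F f (𝟙 w) ≫ extMap F f' (𝟙 w)
        rw [← extMap_comp, Category.comp_id] }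
    (fun _ _ _ _ h => by
      ext ⟨w⟩
      exact extMap_congr F h ⟨Arrow.RightHomotopy.refl (𝟙 w)⟩)

end Extension

section Tensor

variable {C : Type u} [Category.{v} C] [Preadditive C] [HasBinaryBiproducts C]

/-- The object `(a ⟵ r)` of the Freyd category given by `ρ : r ⟶ a`. -/
abbrev ofHom {r a : C} (ρ : r ⟶ a) : RightFreyd C := (RightFreyd.quotient C).obj (Arrow.mk ρ)

section Embedding

open ZeroObject

variable [HasZeroObject C]

/-- The object `a` seen as the object `(a ⟵ 0)` of the Freyd category. -/
abbrev emb (a : C) : RightFreyd C := (RightFreyd.functor C).obj a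

/-- The morphism `(r ⟵ 0) ⟶ (a ⟵ 0)` given by `ρ : r ⟶ a`. -/
abbrev embMap {r a : C} (ρ : r ⟶ a) : emb r ⟶ emb a := (RightFreyd.functor C).map ρ

/-- The canonical morphism `(a ⟵ 0) ⟶ (a ⟵ r)` given by the identity of `a`. -/
def toOfHom {r a : C} (ρ : r ⟶ a) : emb a ⟶ ofHom ρ :=
  (RightFreyd.quotient C).map
    (Arrow.homMk 0 (𝟙 a) (by simp) : Arrow.mk (0 : 0 ⟶ a) ⟶ Arrow.mk ρ)

end Embedding

variable (T : C ⥤ C ⥤ RightFreyd C) [∀ b, (T.flip.obj b).Additive] [∀ a, (T.obj a).Additive]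

/-- The functor `(- ⊗ X)` on the Freyd category, where `⊗` is the extension of `T`. -/
def tensorRight (X : RightFreyd C) : RightFreyd C ⥤ RightFreyd C :=
  (extension T).flip.obj X

/-- The natural transformation `(- ⊗ f) : (- ⊗ X) ⟶ (- ⊗ Y)`. -/
def tensorRightMap {X Y : RightFreyd C} (f : X ⟶ Y) : tensorRight T X ⟶ tensorRight T Y :=
  (extension T).flip.map f

/-- The natural transformation `Hom(f, -) : Hom(Y, -) ⟶ Hom(X, -)` induced by `f : X ⟶ Y` on given
right adjoints `Hom(X, -)` of `(- ⊗ X)` and `Hom(Y, -)` of `(- ⊗ Y)`: the one that corresponds under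
the adjunctions to precomposition `Hom(W ⊗ Y, Z) ⟶ Hom(W ⊗ X, Z)` with `W ⊗ f`. -/
def homMap {X Y : RightFreyd C} (f : X ⟶ Y) {homX homY : RightFreyd C ⥤ RightFreyd C}
    (adjX : tensorRight T X ⊣ homX) (adjY : tensorRight T Y ⊣ homY) : homY ⟶ homX :=
  conjugateEquiv adjY adjX (tensorRightMap T f)

end Tensor

end

end FreydTensor

namespace FreydTensor

/-! ### Kernels in the Freyd category from weak kernels -/

section Kernels

variable {C : Type u} [Category.{v} C] [Preadditive C]

/-! For each `W`, the object `W ⊗ A` is the cokernel of `W ⊗ ρ : W ⊗ r ⟶ W ⊗ a`, since the relations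
coming from `ρ` are exactly what separates `W ⊗ a` from `W ⊗ A` (`isColimitExtMapArrowProj`). Hence
`Hom(W ⊗ A, Z)` is the kernel of `Hom(W ⊗ a, Z) ⟶ Hom(W ⊗ r, Z)`. Transposing along the two
adjunctions, it is the kernel of `Hom(W, homa Z) ⟶ Hom(W, homr Z)`, naturally in `W`, so it is
represented by the kernel of `homa Z ⟶ homr Z` (`exists_rightAdjoint_of_isColimit_cokernelCofork`).
That kernel exists because weak kernels in `C` give kernels in the Freyd category
(`hasKernel_quotient_map`). -/

theorem hasKernel_quotient_map [HasBinaryBiproducts C] [HasWeakKernels C] {x y : Arrow C}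
    (f : x ⟶ y) : HasKernel ((RightFreyd.quotient C).map f) := by
  let Q := RightFreyd.quotient C
  -- Weak pullbacks, obtained as weak kernels.
  have weakPullback : ∀ {a b c : C} (p : a ⟶ c) (q : b ⟶ c),
      ∃ (k : C) (i : k ⟶ a) (j : k ⟶ b), i ≫ p = j ≫ q ∧
        ∀ {t : C} (m : t ⟶ a) (n : t ⟶ b), m ≫ p = n ≫ q →
          ∃ l : t ⟶ k, l ≫ i = m ∧ l ≫ j = n := by
    intro a b c p q
    let d : a ⊞ b ⟶ c := biprod.desc p (-q)
    refine ⟨weakKernel d, weakKernel.ι d ≫ biprod.fst, weakKernel.ι d ≫ biprod.snd, ?_, ?_⟩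
    · have h : d = biprod.fst ≫ p - biprod.snd ≫ q := by
        apply biprod.hom_ext' <;> simp [d]
      have h' := weakKernel.condition d
      conv at h' => lhs; arg 2; rw [h]
      rw [comp_sub, sub_eq_zero] at h'
      simpa using h'
    · intro t m n h
      have hl : biprod.lift m n ≫ d = 0 := by simp [d, h]
      exact ⟨weakKernel.lift d _ hl, by
        rw [← Category.assoc, weakKernel.lift_ι, biprod.lift_fst], by
        rw [← Category.assoc, weakKernel.lift_ι, biprod.lift_snd]⟩
  -- The kernel object is `s : p ⟶ k`: `k` weakly classifies the maps into `x.right` that `f` sends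
  -- into the image of `y.hom`, and `p` weakly classifies the relations among them that already hold
  -- in `x`.
  obtain ⟨k, i, j, hij, hk⟩ := weakPullback f.right y.hom
  obtain ⟨p, s, t, hst, hp⟩ := weakPullback i x.hom
  let κ : Arrow.mk s ⟶ x := Arrow.homMk t i hst.symm
  have w : Q.map κ ≫ Q.map f = 0 := by
    rw [← Q.map_comp]
    exact RightFreyd.quotient_map_eq_zero_iff _ |>.2 ⟨⟨j, by simpa [κ] using hij⟩⟩
  -- Strict uniqueness, although `k` and `p` are only weak: if `m.right ≫ i` factors through
  -- `x.hom`, the second weak pullback factors `m.right` through `s`, which makes `m` zero in the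
  -- quotient.
  have : Mono (Q.map κ) := by
    refine mono_of_cancel_zero _ fun {z} m hm => ?_
    obtain ⟨z, rfl⟩ : ∃ z', Q.obj z' = z := ⟨z.as, rfl⟩
    obtain ⟨m, rfl⟩ := Q.map_surjective m
    rw [← Q.map_comp] at hm
    obtain ⟨h⟩ := (RightFreyd.quotient_map_eq_zero_iff _).1 hm
    obtain ⟨l, hl, -⟩ := hp m.right h.hom (by simpa [κ] using h.comm)
    exact (RightFreyd.quotient_map_eq_zero_iff _).2 ⟨⟨l, by simpa using hl.symm⟩⟩
  refine ⟨⟨⟨KernelFork.ofι (Q.map κ) w,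
    KernelFork.IsLimit.ofι' _ w fun {z} g hg => Nonempty.some ?_⟩⟩⟩
  obtain ⟨z, rfl⟩ : ∃ z', Q.obj z' = z := ⟨z.as, rfl⟩
  obtain ⟨g, rfl⟩ := Q.map_surjective g
  rw [← Q.map_comp] at hg
  obtain ⟨h⟩ := (RightFreyd.quotient_map_eq_zero_iff _).1 hg
  obtain ⟨l, hl, -⟩ := hk g.right h.hom (by simpa using h.comm)
  -- `l` lifts `g.right`; it becomes a morphism of arrows once its relation component is supplied by
  -- the second weak pullback.
  obtain ⟨l', hl', hl''⟩ := hp (z.hom ≫ l) g.left (by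
    rw [Category.assoc, hl]; exact g.w.symm)
  refine ⟨⟨Q.map (Arrow.homMk l' l hl' : z ⟶ Arrow.mk s), ?_⟩⟩
  rw [← Q.map_comp]
  congr 1
  ext
  · exact hl''
  · exact hl

instance hasKernels_rightFreyd [HasBinaryBiproducts C] [HasWeakKernels C] :
    HasKernels (RightFreyd C) where
  has_limit g := by
    obtain ⟨f, rfl⟩ := (RightFreyd.quotient C).map_surjective g
    exact hasKernel_quotient_map f

instance hasZeroObject_rightFreyd [HasZeroObject C] : HasZeroObject (RightFreyd C) :=
  ⟨_, (RightFreyd.functor C).map_isZero (isZero_zero C)⟩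

end Kernels

/-! ### Right adjoints of cokernels of left adjoints -/

section Adjoint

/-- Used to carry vanishing conditions from one side of the adjunctions to the other. -/
theorem homEquiv_conjugateEquiv {A : Type u₁} [Category.{v₁} A] {B : Type u₂} [Category.{v₂} B]
    {L₁ L₂ : A ⥤ B} {R₁ R₂ : B ⥤ A} (adj₁ : L₁ ⊣ R₁) (adj₂ : L₂ ⊣ R₂) (α : L₂ ⟶ L₁)
    {X : A} {Z : B} (g : L₁.obj X ⟶ Z) :
    adj₁.homEquiv X Z g ≫ (conjugateEquiv adj₁ adj₂ α).app Z =
      adj₂.homEquiv X Z (α.app X ≫ g) := by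
  simp only [Adjunction.homEquiv_unit, Category.assoc, Functor.map_comp, NatTrans.naturality]
  rw [← Category.assoc, unit_conjugateEquiv, Category.assoc]

variable {A : Type u₁} [Category.{v₁} A] [Preadditive A] [HasZeroObject A] [HasKernels A]
  {B : Type u₂} [Category.{v₂} B] [Preadditive B] [HasZeroObject B]

/-- If `L` is the pointwise cokernel of a natural transformation between left adjoints, then `L`
has a right adjoint, which is the pointwise kernel of the conjugate transformation. -/
theorem exists_rightAdjoint_of_isColimit_cokernelCofork {L₁ L₂ L : A ⥤ B} {R₁ R₂ : B ⥤ A}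
    (adj₁ : L₁ ⊣ R₁) (adj₂ : L₂ ⊣ R₂) (α : L₁ ⟶ L₂) (π : L₂ ⟶ L)
    (w : ∀ X, α.app X ≫ π.app X = 0)
    (hπ : ∀ X, IsColimit (CokernelCofork.ofπ (π.app X) (w X))) :
    ∃ (R : B ⥤ A) (adj : L ⊣ R), ∀ Z : B,
      ∃ w : (conjugateEquiv adj adj₂ π).app Z ≫ (conjugateEquiv adj₂ adj₁ α).app Z = 0,
        Nonempty (IsLimit (KernelFork.ofι ((conjugateEquiv adj adj₂ π).app Z) w)) := by
  let β := conjugateEquiv adj₂ adj₁ α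
  have := adj₁.isLeftAdjoint
  have homEquiv_zero (X Z) : adj₁.homEquiv X Z 0 = 0 := by
    rw [← Equiv.eq_symm_apply, Adjunction.homEquiv_counit, Functor.map_zero, zero_comp]
  have epi (X) : Epi (π.app X) := Cofork.IsColimit.epi (hπ X)
  -- Maps out of the cokernel `L.obj X` are maps out of `L₂.obj X` killed by `α`; their transposes
  -- are the maps into `R₂.obj Z` killed by `β`.
  let e (X : A) (Z : B) : (L.obj X ⟶ Z) ≃ (X ⟶ kernel (β.app Z)) :=
    { toFun := fun g => kernel.lift (β.app Z) (adj₂.homEquiv X Z (π.app X ≫ g)) (by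
        rw [homEquiv_conjugateEquiv, reassoc_of% (w X), zero_comp, homEquiv_zero])
      invFun := fun h => (hπ X).desc (CokernelCofork.ofπ
        ((adj₂.homEquiv X Z).symm (h ≫ kernel.ι (β.app Z))) (by
          rw [← (adj₁.homEquiv X Z).apply_eq_iff_eq, homEquiv_zero, ← homEquiv_conjugateEquiv adj₂,
            Equiv.apply_symm_apply, Category.assoc, kernel.condition, Limits.comp_zero]))
      left_inv := fun g => by
        rw [← cancel_epi (π.app X)]
        refine ((hπ X).fac _ WalkingParallelPair.one).trans ?_
        simp
      right_inv := fun h => by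
        rw [← cancel_mono (kernel.ι (β.app Z)), kernel.lift_ι]
        refine (congrArg _ ((hπ X).fac _ WalkingParallelPair.one)).trans ?_
        simp }
  have e_ι {X Z} (g : L.obj X ⟶ Z) :
      e X Z g ≫ kernel.ι (β.app Z) = adj₂.homEquiv X Z (π.app X ≫ g) := kernel.lift_ι _ _ _
  have he (X' X Z) (f : X' ⟶ X) (g : L.obj X ⟶ Z) : e X' Z (L.map f ≫ g) = f ≫ e X Z g := by
    rw [← cancel_mono (kernel.ι (β.app Z)), Category.assoc, e_ι, e_ι,
      ← Adjunction.homEquiv_naturality_left, NatTrans.naturality_assoc]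
  let adj := Adjunction.adjunctionOfEquivRight e he
  -- Yoneda argument: the transposition formula is evaluated at the counit, the morphism
  -- corresponding to the identity of the kernel.
  have hι (Z) : (conjugateEquiv adj adj₂ π).app Z = kernel.ι (β.app Z) := by
    have h := homEquiv_conjugateEquiv adj adj₂ π ((e (kernel (β.app Z)) Z).symm (𝟙 _))
    rw [← e_ι, Equiv.apply_symm_apply] at h
    have h' : adj.homEquiv _ Z ((e (kernel (β.app Z)) Z).symm (𝟙 _)) = 𝟙 _ := by
      simp [adj, Adjunction.adjunctionOfEquivRight]
    rw [h'] at h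
    exact (Category.id_comp _).symm.trans (h.trans (Category.id_comp _))
  refine ⟨_, adj, fun Z => ?_⟩
  simp only [hι]
  exact ⟨kernel.condition (β.app Z), ⟨kernelIsKernel (β.app Z)⟩⟩

end Adjoint

/-! ### Right exactness of the extension on the presentation of an object -/

section ExtensionCokernel

open ZeroObject

variable {C : Type u₁} [Category.{v₁} C] {D : Type u₂} [Category.{v₂} D] [Preadditive D]
  [HasZeroObject D] {B : Type u₃} [Category.{v₃} B] [Preadditive B] [HasBinaryBiproducts B]
  [HasCokernels B] (F : C ⥤ D ⥤ B) (u : Arrow C) {r a : D} (ρ : r ⟶ a)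

/-- The morphism `(r ⟵ 0) ⟶ (a ⟵ 0)` of arrows given by `ρ : r ⟶ a`. -/
noncomputable abbrev arrowMap : Arrow.mk (0 : 0 ⟶ r) ⟶ Arrow.mk (0 : 0 ⟶ a) :=
  Arrow.homMk 0 ρ

/-- The morphism `(a ⟵ 0) ⟶ (a ⟵ r)` of arrows given by the identity of `a`. -/
noncomputable abbrev arrowProj : Arrow.mk (0 : 0 ⟶ a) ⟶ Arrow.mk ρ :=
  Arrow.homMk 0 (𝟙 a) (by simp)

theorem extπ_extMap_arrowMap :
    extπ F u _ ≫ extMap F (𝟙 u) (arrowMap ρ) =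
      (F.obj u.right).map ρ ≫ extπ F u (Arrow.mk (0 : 0 ⟶ a)) := by
  rw [extπ_extMap]
  simp

theorem extπ_extMap_arrowProj :
    extπ F u _ ≫ extMap F (𝟙 u) (arrowProj ρ) = extπ F u (Arrow.mk ρ) := by
  rw [extπ_extMap]
  simp

theorem extMap_arrowMap_arrowProj :
    extMap F (𝟙 u) (arrowMap ρ) ≫ extMap F (𝟙 u) (arrowProj ρ) = 0 := by
  rw [← cancel_epi (extπ F u _), ← Category.assoc, extπ_extMap_arrowMap, Category.assoc,
    extπ_extMap_arrowProj, Limits.comp_zero]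
  exact right_extπ F u (Arrow.mk ρ)

/-- `F̂(u, a ⟵ r)` is the cokernel of `F̂(u, ρ) : F̂(u, r) ⟶ F̂(u, a)`. -/
noncomputable def isColimitExtMapArrowProj :
    IsColimit (CokernelCofork.ofπ (extMap F (𝟙 u) (arrowProj ρ))
      (extMap_arrowMap_arrowProj F u ρ)) := by
  have : Epi (extπ F u _ ≫ extMap F (𝟙 u) (arrowProj ρ)) := by
    rw [extπ_extMap_arrowProj]
    infer_instance
  have : Epi (extMap F (𝟙 u) (arrowProj ρ)) := epi_of_epi (extπ F u _) _
  refine CokernelCofork.IsColimit.ofπ' _ _ fun g hg =>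
    ⟨cokernel.desc (relMap F u (Arrow.mk ρ)) (extπ F u (Arrow.mk (0 : 0 ⟶ a)) ≫ g) ?_, ?_⟩
  -- The relations from `u` already vanish in `F̂(u, a ⟵ 0)`; those from `ρ` are killed by `g`
  -- because of `hg`.
  · apply biprod.hom_ext'
    · have h := left_extπ F u (Arrow.mk (0 : 0 ⟶ a)) =≫ g
      simpa [relMap] using h
    · have h := extπ F u _ ≫= hg
      rw [← Category.assoc, extπ_extMap_arrowMap] at h
      simpa [relMap] using h
  · rw [← cancel_epi (extπ F u _), ← Category.assoc, extπ_extMap_arrowProj]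
    exact cokernel.π_desc _ _ _

end ExtensionCokernel

section TensorCokernel

variable {C : Type u} [Category.{v} C] [Preadditive C] [HasBinaryBiproducts C] [HasZeroObject C]
  (T : C ⥤ C ⥤ RightFreyd C) [∀ b, (T.flip.obj b).Additive] [∀ a, (T.obj a).Additive]
  {r a : C} (ρ : r ⟶ a)

/-- `embMap ρ` and `toOfHom ρ` are the classes of `arrowMap ρ` and `arrowProj ρ`, so tensoring with
them unfolds definitionally to `extMap`. -/
theorem tensorRightMap_embMap_toOfHom (W : RightFreyd C) :
    (tensorRightMap T (embMap ρ)).app W ≫ (tensorRightMap T (toOfHom ρ)).app W = 0 :=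
  extMap_arrowMap_arrowProj T W.as ρ

/-- `W ⊗ (a ⟵ r)` is the cokernel of `W ⊗ ρ : W ⊗ r ⟶ W ⊗ a`. -/
noncomputable def isColimitTensorRightMapToOfHom (W : RightFreyd C) :
    IsColimit (CokernelCofork.ofπ ((tensorRightMap T (toOfHom ρ)).app W)
      (tensorRightMap_embMap_toOfHom T ρ W)) :=
  isColimitExtMapArrowProj T W.as ρ

end TensorCokernel

end FreydTensor

theorem mainTheorem4 {C : Type u} [Category.{v} C]
    -- `C` is an additive category with weak kernels
    [Preadditive C] [HasZeroObject C] [HasBinaryBiproducts C] [HasWeakKernels C]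
    -- a bilinear functor `C × C ⟶ 𝒜(C)`, whose extension to `𝒜(C)` is the tensor product
    (T : C ⥤ C ⥤ RightFreyd C) [∀ b, (T.flip.obj b).Additive] [∀ a, (T.obj a).Additive]
    -- the object `A = (a ⟵ r)` is `ofHom ρ`
    {r a : C} (ρ : r ⟶ a)
    {homa homr : RightFreyd C ⥤ RightFreyd C}
    (adja : FreydTensor.tensorRight T (FreydTensor.emb a) ⊣ homa)
    (adjr : FreydTensor.tensorRight T (FreydTensor.emb r) ⊣ homr) :
    ∃ (homA : RightFreyd C ⥤ RightFreyd C)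
      (adjA : FreydTensor.tensorRight T (FreydTensor.ofHom ρ) ⊣ homA),
      -- `Hom(A, Z) ⟶ Hom(a, Z)` is a kernel of `Hom(a, Z) ⟶ Hom(r, Z)` for every `Z`
      ∀ Z : RightFreyd C,
        ∃ w : (FreydTensor.homMap T (FreydTensor.toOfHom ρ) adja adjA).app Z ≫
            (FreydTensor.homMap T (FreydTensor.embMap ρ) adjr adja).app Z = 0,
          Nonempty (IsLimit (KernelFork.ofι
            ((FreydTensor.homMap T (FreydTensor.toOfHom ρ) adja adjA).app Z) w)) := by
  exact FreydTensor.exists_rightAdjoint_of_isColimit_cokernelCofork adjr adja _ _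
    (FreydTensor.tensorRightMap_embMap_toOfHom T ρ) (FreydTensor.isColimitTensorRightMapToOfHom T ρ)
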